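/- Formulas are built from a countably infinite set of variables $p_0,p_1,\dots$ with the connectives $\cdot,\backslash,\wedge,\vee$ (binary) and $\neg$ (unary); a sequent is an expression $\alpha\Rightarrow\beta$ with formulas $\alpha,\beta$. The class $\mathrm{In}c\mathcal{RL}^-$ of involutive commutative residuated lattice-ordered semigroups (without unit) consists of the algebras $(A,\wedge,\vee,\cdot,\backslash,\neg)$ such that $(A,\wedge,\vee)$ is a lattice with order $\le$, $(A,\cdot)$ is a commutative semigroup, and for all $a,b,c\in A$: $a\cdot b\le c$ iff $b\le a\backslash c$; $\neg\neg a=a$; $a\le\neg c$ implies $c\le\neg a$; and $a\backslash\neg b=b\backslash\neg a$. A sequent $\alpha\Rightarrow\beta$ is valid if $\mu(\alpha)\le\mu(\beta)$ for every algebra of the class and every assignment $\mu$ of elements of the algebra to the variables, extended homomorphically to formulas. The logic $\mathrm{InFL}^-_e$ is the logic of this class. The simple sequent calculus $\mathsf G$ has the axioms $\alpha\Rightarrow\alpha$, $\neg\neg\alpha\Rightarrow\alpha$, $\alpha\cdot\beta\Rightarrow\beta\cdot\alpha$, $(\alpha\cdot\beta)\cdot\gamma\Rightarrow\alpha\cdot(\beta\cdot\gamma)$,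 $\alpha\cdot(\beta\cdot\gamma)\Rightarrow(\alpha\cdot\beta)\cdot\gamma$, and the rules - from $\alpha\cdot\beta\Rightarrow\gamma$ infer $\beta\Rightarrow\alpha\backslash\gamma$, and conversely; - from $\alpha\Rightarrow\beta$ infer $\alpha\wedge\gamma\Rightarrow\beta$ and $\gamma\wedge\alpha\Rightarrow\beta$; from $\alpha\Rightarrow\beta$ and $\alpha\Rightarrow\gamma$ infer $\alpha\Rightarrow\beta\wedge\gamma$; - from $\alpha\Rightarrow\beta$ and $\gamma\Rightarrow\beta$ infer $\alpha\vee\gamma\Rightarrow\beta$; from $\alpha\Rightarrow\beta$ infer $\alpha\Rightarrow\beta\vee\gamma$ and $\alpha\Rightarrow\gamma\vee\beta$; - from $\alpha\cdot\beta\Rightarrow\neg\gamma$ infer $\gamma\cdot\beta\Rightarrow\neg\alpha$; from $\alpha\Rightarrow\neg\gamma$ infer $\gamma\Rightarrow\neg\alpha$; - (Cut) from $\alpha\Rightarrow\beta$ and $\beta\Rightarrow\gamma$ infer $\alpha\Rightarrow\gamma$. Theorem. The logic $\mathrm{InFL}^-_e$ is decidable: the set of sequents valid in $\mathrm{In}c\mathcal{RL}^-$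 is decidable. Equivalently, derivability in $\mathsf G$ is decidable: the set of sequents derivable in $\mathsf G$ is decidable. Moreover these two sets coincide: a sequent is derivable in $\mathsf G$ iff it is valid in $\mathrm{In}c\mathcal{RL}^-$. -/

import Mathlib

universe u

namespace InFLe

/-- Formulas over the countably infinite set of variables `p₀, p₁, p₂, …`.
`ldiv α β` is `α \ β`. -/
inductive Formula : Type
  | var (p : ℕ) : Formula
  | neg (α : Formula) : Formula
  | fusion (α β : Formula) : Formula
  | ldiv (α β : Formula) : Formula
  | inf (α β : Formula) : Formula
  | sup (α β : Formula) : Formula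

namespace Formula

/-- Gödel number of a formula. -/
def toNat : Formula → ℕ
  | var p => 6 * p
  | neg α => 6 * toNat α + 1
  | fusion α β => 6 * Nat.pair (toNat α) (toNat β) + 2
  | ldiv α β => 6 * Nat.pair (toNat α) (toNat β) + 3
  | inf α β => 6 * Nat.pair (toNat α) (toNat β) + 4
  | sup α β => 6 * Nat.pair (toNat α) (toNat β) + 5

theorem div_six_lt {n : ℕ} (h : n % 6 ≠ 0) : n / 6 < n := by omega

theorem unpair_fst_lt {n : ℕ} (h : n % 6 ≠ 0) : (Nat.unpair (n / 6)).1 < n :=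
  lt_of_le_of_lt (Nat.unpair_left_le _) (div_six_lt h)

theorem unpair_snd_lt {n : ℕ} (h : n % 6 ≠ 0) : (Nat.unpair (n / 6)).2 < n :=
  lt_of_le_of_lt (Nat.unpair_right_le _) (div_six_lt h)

theorem pair_cancel {a b c d r : ℕ} (h : 6 * Nat.pair a b + r = 6 * Nat.pair c d + r) :
    a = c ∧ b = d :=
  Nat.pair_eq_pair.1 (by omega)

theorem toNat_injective : ∀ {α β : Formula}, toNat α = toNat β → α = β := by
  intro α
  induction α with
  | var p => intro β h; cases β <;> simp only [toNat] at h <;> first | omega | (congr 1; omega)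
  | neg α ih =>
    intro β h
    cases β <;> simp only [toNat] at h <;> first | omega | (congr 1; exact ih (by omega))
  | fusion α₁ α₂ ih₁ ih₂ =>
    intro β h
    cases β <;> simp only [toNat] at h <;> first
      | omega
      | (rw [ih₁ (pair_cancel h).1, ih₂ (pair_cancel h).2])
  | ldiv α₁ α₂ ih₁ ih₂ =>
    intro β h
    cases β <;> simp only [toNat] at h <;> first
      | omega
      | (rw [ih₁ (pair_cancel h).1, ih₂ (pair_cancel h).2])
  | inf α₁ α₂ ih₁ ih₂ =>
    intro β h
    cases β <;> simp only [toNat] at h <;> first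
      | omega
      | (rw [ih₁ (pair_cancel h).1, ih₂ (pair_cancel h).2])
  | sup α₁ α₂ ih₁ ih₂ =>
    intro β h
    cases β <;> simp only [toNat] at h <;> first
      | omega
      | (rw [ih₁ (pair_cancel h).1, ih₂ (pair_cancel h).2])

/-- The formula with a given Gödel number. -/
def ofNat (n : ℕ) : Formula :=
  if h : n % 6 = 0 then var (n / 6)
  else if n % 6 = 1 then neg (ofNat (n / 6))
  else if n % 6 = 2 then fusion (ofNat (Nat.unpair (n / 6)).1) (ofNat (Nat.unpair (n / 6)).2)
  else if n % 6 = 3 then ldiv (ofNat (Nat.unpair (n / 6)).1) (ofNat (Nat.unpair (n / 6)).2)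
  else if n % 6 = 4 then inf (ofNat (Nat.unpair (n / 6)).1) (ofNat (Nat.unpair (n / 6)).2)
  else sup (ofNat (Nat.unpair (n / 6)).1) (ofNat (Nat.unpair (n / 6)).2)
termination_by n
decreasing_by
  all_goals first
    | exact div_six_lt h
    | exact unpair_fst_lt h
    | exact unpair_snd_lt h

theorem toNat_ofNat (n : ℕ) : toNat (ofNat n) = n := by
  induction n using Nat.strong_induction_on with
  | _ n ih =>
    rw [ofNat]
    split_ifs with h0 h1 h2 h3 h4 <;> simp only [toNat]
    · omega
    · rw [ih _ (div_six_lt h0)]; omega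
    all_goals
      rw [ih _ (unpair_fst_lt h0), ih _ (unpair_snd_lt h0), Nat.pair_unpair]; omega

/-- The Gödel numbering is a bijection between formulas and natural numbers. -/
def equivNat : Formula ≃ ℕ where
  toFun := toNat
  invFun := ofNat
  left_inv α := toNat_injective (toNat_ofNat (toNat α))
  right_inv := toNat_ofNat

instance instPrimcodable : Primcodable Formula := Primcodable.ofEquiv ℕ equivNat

end Formula

open Formula in
/-- `G α β`: the sequent `α ⇒ β` is derivable in the simple sequent calculus `G`. The rule `mn` is
the instance of `neg` in which the side formula `β` is absent. -/
inductive G : Formula → Formula → Prop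
  | id (α) : G α α
  | dn2 (α) : G (neg (neg α)) α
  | comm (α β) : G (fusion α β) (fusion β α)
  | assoc₁ (α β γ) : G (fusion (fusion α β) γ) (fusion α (fusion β γ))
  | assoc₂ (α β γ) : G (fusion α (fusion β γ)) (fusion (fusion α β) γ)
  | res {α β γ} : G (fusion α β) γ → G β (ldiv α γ)
  | res_inv {α β γ} : G β (ldiv α γ) → G (fusion α β) γ
  | inf_left₁ {α β γ} : G α β → G (inf α γ) β
  | inf_left₂ {α β γ} : G α β → G (inf γ α) β
  | inf_right {α β γ} : G α β → G α γ → G α (inf β γ)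
  | sup_left {α β γ} : G α β → G γ β → G (sup α γ) β
  | sup_right₁ {α β γ} : G α β → G α (sup β γ)
  | sup_right₂ {α β γ} : G α β → G α (sup γ β)
  | neg {α β γ} : G (fusion α β) (neg γ) → G (fusion γ β) (neg α)
  | mn {α γ} : G α (neg γ) → G γ (neg α)
  | cut {α β γ} : G α β → G β γ → G α γ

/-- Commutative residuated lattice-ordered semigroups (without unit) with an involutive
negation. -/
class InCRLSemigroup (A : Type u) extends Lattice A, CommSemigroup A where
  /-- The residual `a \ b`. -/
  ldiv : A → A → A
  /-- The negation `¬ a`. -/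
  neg : A → A
  mul_le_iff_le_ldiv : ∀ a b c : A, a * b ≤ c ↔ b ≤ ldiv a c
  neg_neg : ∀ a : A, neg (neg a) = a
  le_neg_of_le_neg : ∀ a c : A, a ≤ neg c → c ≤ neg a
  ldiv_neg : ∀ a b : A, ldiv a (neg b) = ldiv b (neg a)

/-- The value of a formula under an assignment `μ`. -/
def eval {A : Type u} [InCRLSemigroup A] (μ : ℕ → A) : Formula → A
  | .var p => μ p
  | .neg α => InCRLSemigroup.neg (eval μ α)
  | .fusion α β => eval μ α * eval μ β
  | .ldiv α β => InCRLSemigroup.ldiv (eval μ α) (eval μ β)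
  | .inf α β => eval μ α ⊓ eval μ β
  | .sup α β => eval μ α ⊔ eval μ β

/-- `α ⇒ β` is valid: `α ≤ β` holds in every algebra of the class under every assignment. -/
def Valid (α β : Formula) : Prop :=
  ∀ (A : Type u) [InCRLSemigroup A] (μ : ℕ → A), eval μ α ≤ eval μ β

end InFLe

/-! Cut makes `G` useless for proof search, so derivability is transferred to a one-sided cut-free
calculus on multisets of signed formulas, where α ⇒ β becomes the multiset of β and the negated α.
Read backwards, its rules have no contraction: every premise has smaller total weight than the
conclusion, only finitely many rules apply to a given multiset, and exhaustive backward search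
decides derivability.

The equivalence of the calculi is proved semantically. Cut-free derivability implies validity
(`CutFree.sound`), validity implies derivability in `G` by the Lindenbaum algebra (`G.complete`),
and `G` is sound (`G.sound`). The remaining implication, from validity to cut-free derivability, is
cut elimination in the manner of Okada: in the phase algebra of nonempty contexts whose pole is the
set of cut-free derivable contexts, the value of α contains the one-element context of the negated α
and is contained in the orthogonal of α (`cutFree_of_mem_eval`). Applied to a valid α ⇒ β, this says
that the context of α and β is cut-free derivable (`Valid.cutFree`).

Contexts stay nonempty because the algebras have no unit: if contexts could be empty, p ⇒ p·(q\q)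
would become derivable. -/

namespace InFLe

/-! ### The phase algebra of a commutative semigroup with a pole -/

section Phase

variable {M : Type u} [AddCommSemigroup M] (D : Set M)

/-- The orthogonal of a set relative to the pole `D`. -/
def perp (X : Set M) : Set M := {x | ∀ y ∈ X, x + y ∈ D}

theorem perp_anti {X Y : Set M} (h : X ⊆ Y) : perp D Y ⊆ perp D X :=
  fun _ hx y hy => hx y (h hy)

theorem subset_perp_perp (X : Set M) : X ⊆ perp D (perp D X) :=
  fun x hx y hy => by rw [add_comm]; exact hy x hx

theorem subset_perp_comm {X Y : Set M} (h : X ⊆ perp D Y) : Y ⊆ perp D X :=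
  (subset_perp_perp D Y).trans (perp_anti D h)

theorem perp_perp_perp (X : Set M) : perp D (perp D (perp D X)) = perp D X :=
  (perp_anti D (subset_perp_perp D X)).antisymm (subset_perp_perp D _)

/-- Elementwise sums of two sets. -/
def sums (X Y : Set M) : Set M := {z | ∃ x ∈ X, ∃ y ∈ Y, z = x + y}

theorem sums_comm (X Y : Set M) : sums X Y = sums Y X := by
  ext z
  constructor <;> rintro ⟨x, hx, y, hy, rfl⟩ <;> exact ⟨y, hy, x, hx, add_comm _ _⟩

theorem sums_assoc (X Y Z : Set M) : sums (sums X Y) Z = sums X (sums Y Z) := by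
  ext w
  constructor
  · rintro ⟨_, ⟨x, hx, y, hy, rfl⟩, z, hz, rfl⟩
    exact ⟨x, hx, _, ⟨y, hy, z, hz, rfl⟩, add_assoc _ _ _⟩
  · rintro ⟨x, hx, _, ⟨y, hy, z, hz, rfl⟩, rfl⟩
    exact ⟨_, ⟨x, hx, y, hy, rfl⟩, z, hz, (add_assoc _ _ _).symm⟩

/-- Residuation of elementwise sums into orthogonals. -/
theorem sums_subset_perp_iff (X Y Z : Set M) :
    sums X Y ⊆ perp D Z ↔ Y ⊆ perp D (sums X Z) := by
  constructor
  · rintro h y hy _ ⟨x, hx, z, hz, rfl⟩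
    have := h ⟨x, hx, y, hy, rfl⟩ z hz
    rwa [add_left_comm, ← add_assoc]
  · rintro h _ ⟨x, hx, y, hy, rfl⟩ z hz
    have := h hy _ ⟨x, hx, z, hz, rfl⟩
    rwa [add_assoc, add_left_comm]

/-- Biorthogonal closure of a factor is invisible to the orthogonal of a sum: residuation moves X to
the other side, where the triple orthogonal collapses. Associativity of the product of facts rests
on this. -/
theorem perp_sums_perp_perp (X Y : Set M) :
    perp D (sums X (perp D (perp D Y))) = perp D (sums X Y) := by
  refine (perp_anti D ?_).antisymm ?_
  · rintro _ ⟨x, hx, y, hy, rfl⟩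
    exact ⟨x, hx, y, subset_perp_perp D Y hy, rfl⟩
  · rw [← sums_subset_perp_iff, perp_perp_perp, sums_subset_perp_iff]

/-- The sets that are equal to their biorthogonal. -/
def Fact : Type u := {X : Set M // perp D (perp D X) = X}

namespace Fact

variable {D}

/-- The orthogonal of a set, as a fact. -/
def ofPerp (X : Set M) : Fact D := ⟨perp D X, perp_perp_perp D X⟩

theorem perp_perp_subset_iff {X : Set M} {Y : Fact D} : perp D (perp D X) ⊆ Y.1 ↔ X ⊆ Y.1 :=
  ⟨(subset_perp_perp D X).trans, fun h => by
    rw [← Y.2]; exact perp_anti D (perp_anti D h)⟩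

instance : Lattice (Fact D) where
  le X Y := X.1 ⊆ Y.1
  le_refl X := subset_rfl
  le_trans X Y Z h h' := h.trans h'
  le_antisymm X Y h h' := Subtype.ext (h.antisymm h')
  inf X Y := ⟨X.1 ∩ Y.1, by
    refine (Set.subset_inter ?_ ?_).antisymm (subset_perp_perp D _)
    · exact perp_perp_subset_iff.2 Set.inter_subset_left
    · exact perp_perp_subset_iff.2 Set.inter_subset_right⟩
  inf_le_left X Y := Set.inter_subset_left
  inf_le_right X Y := Set.inter_subset_right
  le_inf X Y Z h h' := Set.subset_inter h h'
  sup X Y := ofPerp (perp D (X.1 ∪ Y.1))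
  le_sup_left X Y := Set.subset_union_left.trans (subset_perp_perp D _)
  le_sup_right X Y := Set.subset_union_right.trans (subset_perp_perp D _)
  sup_le X Y Z h h' := perp_perp_subset_iff.2 (Set.union_subset h h')

instance : CommSemigroup (Fact D) where
  mul X Y := ofPerp (perp D (sums X.1 Y.1))
  mul_comm X Y := by
    change ofPerp (perp D (sums X.1 Y.1)) = ofPerp (perp D (sums Y.1 X.1))
    rw [sums_comm]
  mul_assoc X Y Z := by
    change ofPerp (perp D (sums (perp D (perp D (sums X.1 Y.1))) Z.1)) =
      ofPerp (perp D (sums X.1 (perp D (perp D (sums Y.1 Z.1)))))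
    rw [perp_sums_perp_perp, sums_comm _ Z.1, perp_sums_perp_perp, sums_comm Z.1, sums_assoc]

/-- The residual is the orthogonal of X + Y⊥, so the law for `ldiv` and `neg` reduces to
commutativity of sums. -/
instance : InCRLSemigroup (Fact D) where
  ldiv X Y := ofPerp (sums X.1 (perp D Y.1))
  neg X := ofPerp X.1
  mul_le_iff_le_ldiv X Y Z := by
    change perp D (perp D (sums X.1 Y.1)) ⊆ Z.1 ↔ Y.1 ⊆ perp D (sums X.1 (perp D Z.1))
    rw [perp_perp_subset_iff, ← sums_subset_perp_iff, Z.2]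
  neg_neg X := Subtype.ext X.2
  le_neg_of_le_neg X Z h := subset_perp_comm D h
  ldiv_neg X Y := by
    change ofPerp (sums X.1 (perp D (perp D Y.1))) = ofPerp (sums Y.1 (perp D (perp D X.1)))
    rw [X.2, Y.2, sums_comm]

end Fact

end Phase

/-! ### Soundness and completeness of `G` -/

section Algebra

variable {A : Type u} [InCRLSemigroup A]

open InCRLSemigroup hiding neg_neg

theorem le_neg_comm {a c : A} : a ≤ neg c ↔ c ≤ neg a :=
  ⟨le_neg_of_le_neg a c, le_neg_of_le_neg c a⟩

/-- By residuation both sides bound b, and the bounds a\¬c and c\¬a are equal. This is the algebraic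
content of the rule `G.neg`. -/
theorem mul_le_neg_comm {a b c : A} : a * b ≤ neg c ↔ c * b ≤ neg a := by
  rw [mul_le_iff_le_ldiv, ldiv_neg, ← mul_le_iff_le_ldiv]

theorem neg_le_neg {a b : A} (h : a ≤ b) : neg b ≤ neg a :=
  le_neg_comm.1 (by rwa [InCRLSemigroup.neg_neg])

theorem mul_le_mul_both {a b c d : A} (h : a ≤ b) (h' : c ≤ d) : a * c ≤ b * d := by
  have h₁ : a * c ≤ a * d :=
    (mul_le_iff_le_ldiv _ _ _).2 (h'.trans ((mul_le_iff_le_ldiv _ _ _).1 le_rfl))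
  have h₂ : d * a ≤ d * b :=
    (mul_le_iff_le_ldiv _ _ _).2 (h.trans ((mul_le_iff_le_ldiv _ _ _).1 le_rfl))
  rw [mul_comm d a, mul_comm d b] at h₂
  exact h₁.trans h₂

theorem G.sound {α β : Formula} (h : G α β) (μ : ℕ → A) : eval μ α ≤ eval μ β := by
  induction h with
  | id => exact le_rfl
  | dn2 α => exact (InCRLSemigroup.neg_neg (eval μ α)).le
  | comm α β => exact (mul_comm (eval μ α) (eval μ β)).le
  | assoc₁ α β γ => exact (mul_assoc (eval μ α) (eval μ β) (eval μ γ)).le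
  | assoc₂ α β γ => exact (mul_assoc (eval μ α) (eval μ β) (eval μ γ)).ge
  | res _ ih => exact (mul_le_iff_le_ldiv _ _ _).1 ih
  | res_inv _ ih => exact (mul_le_iff_le_ldiv _ _ _).2 ih
  | inf_left₁ _ ih => exact inf_le_left.trans ih
  | inf_left₂ _ ih => exact inf_le_right.trans ih
  | inf_right _ _ ih ih' => exact le_inf ih ih'
  | sup_left _ _ ih ih' => exact sup_le ih ih'
  | sup_right₁ _ ih => exact ih.trans le_sup_left
  | sup_right₂ _ ih => exact ih.trans le_sup_right
  | neg _ ih => exact mul_le_neg_comm.1 ih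
  | mn _ ih => exact le_neg_comm.1 ih
  | cut _ _ ih ih' => exact ih.trans ih'

end Algebra

namespace G

open Formula

theorem dn1 (α : Formula) : G α (.neg (.neg α)) := mn (id _)

theorem neg_mono {α β : Formula} (h : G α β) : G (.neg β) (.neg α) := mn (cut h (dn1 β))

theorem fusion_right {α β γ : Formula} (h : G β γ) : G (fusion α β) (fusion α γ) :=
  res_inv (cut h (res (id _)))

theorem fusion_mono {α β γ δ : Formula} (h : G α β) (h' : G γ δ) :
    G (fusion α γ) (fusion β δ) :=
  cut (fusion_right h') (cut (comm _ _) (cut (fusion_right h) (comm _ _)))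

theorem ldiv_mono {α β γ δ : Formula} (h : G β α) (h' : G γ δ) : G (ldiv α γ) (ldiv β δ) :=
  res (cut (fusion_mono h (id _)) (cut (res_inv (id _)) h'))

theorem inf_mono {α β γ δ : Formula} (h : G α β) (h' : G γ δ) : G (inf α γ) (inf β δ) :=
  inf_right (inf_left₁ h) (inf_left₂ h')

theorem sup_mono {α β γ δ : Formula} (h : G α β) (h' : G γ δ) : G (sup α γ) (sup β δ) :=
  sup_left (sup_right₁ h) (sup_right₂ h')

theorem ldiv_neg_swap (α β : Formula) : G (ldiv α (.neg β)) (ldiv β (.neg α)) :=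
  res (G.neg (res_inv (id _)))

end G

/-- Interderivability in `G`. -/
instance lindenbaumSetoid : Setoid Formula where
  r α β := G α β ∧ G β α
  iseqv := ⟨fun α => ⟨.id α, .id α⟩, fun h => ⟨h.2, h.1⟩,
    fun h h' => ⟨.cut h.1 h'.1, .cut h'.2 h.2⟩⟩

/-- The Lindenbaum algebra of `G`. -/
def Lindenbaum : Type := Quotient lindenbaumSetoid

namespace Lindenbaum

open Formula

/-- The class of a formula. -/
def mk (α : Formula) : Lindenbaum := Quotient.mk _ α

theorem mk_eq {α β : Formula} (h : G α β) (h' : G β α) : mk α = mk β := Quotient.sound ⟨h, h'⟩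

/-- A binary connective that respects interderivability, on classes. -/
def lift₂ (f : Formula → Formula → Formula)
    (hf : ∀ {α β γ δ}, G α β → G β α → G γ δ → G δ γ → G (f α γ) (f β δ)) :
    Lindenbaum → Lindenbaum → Lindenbaum :=
  Quotient.map₂ f fun _ _ h _ _ h' => ⟨hf h.1 h.2 h'.1 h'.2, hf h.2 h.1 h'.2 h'.1⟩

instance : LE Lindenbaum where
  le := Quotient.lift₂ G fun _ _ _ _ h h' =>
    propext ⟨fun g => .cut h.2 (.cut g h'.1), fun g => .cut h.1 (.cut g h'.2)⟩

instance : Lattice Lindenbaum where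
  le_refl := by rintro ⟨α⟩; exact G.id α
  le_trans := by rintro ⟨α⟩ ⟨β⟩ ⟨γ⟩ h h'; exact G.cut h h'
  le_antisymm := by rintro ⟨α⟩ ⟨β⟩ h h'; exact mk_eq h h'
  inf := lift₂ inf fun h _ h' _ => G.inf_mono h h'
  inf_le_left := by rintro ⟨α⟩ ⟨β⟩; exact G.inf_left₁ (.id α)
  inf_le_right := by rintro ⟨α⟩ ⟨β⟩; exact G.inf_left₂ (.id β)
  le_inf := by rintro ⟨α⟩ ⟨β⟩ ⟨γ⟩ h h'; exact G.inf_right h h'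
  sup := lift₂ sup fun h _ h' _ => G.sup_mono h h'
  le_sup_left := by rintro ⟨α⟩ ⟨β⟩; exact G.sup_right₁ (.id α)
  le_sup_right := by rintro ⟨α⟩ ⟨β⟩; exact G.sup_right₂ (.id β)
  sup_le := by rintro ⟨α⟩ ⟨β⟩ ⟨γ⟩ h h'; exact G.sup_left h h'

instance : CommSemigroup Lindenbaum where
  mul := lift₂ fusion fun h _ h' _ => G.fusion_mono h h'
  mul_assoc := by rintro ⟨α⟩ ⟨β⟩ ⟨γ⟩; exact mk_eq (.assoc₁ α β γ) (.assoc₂ α β γ)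
  mul_comm := by rintro ⟨α⟩ ⟨β⟩; exact mk_eq (.comm α β) (.comm β α)

instance : InCRLSemigroup Lindenbaum where
  ldiv := lift₂ ldiv fun _ h h' _ => G.ldiv_mono h h'
  neg := Quotient.map neg fun _ _ h => ⟨G.neg_mono h.2, G.neg_mono h.1⟩
  mul_le_iff_le_ldiv := by rintro ⟨α⟩ ⟨β⟩ ⟨γ⟩; exact ⟨G.res, G.res_inv⟩
  neg_neg := by rintro ⟨α⟩; exact mk_eq (.dn2 α) (.dn1 α)
  le_neg_of_le_neg := by rintro ⟨α⟩ ⟨γ⟩ h; exact G.mn h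
  ldiv_neg := by
    rintro ⟨α⟩ ⟨β⟩
    exact mk_eq (.ldiv_neg_swap α β) (.ldiv_neg_swap β α)

theorem eval_mk (α : Formula) : eval (fun p => mk (var p)) α = mk α := by
  induction α with
  | var p => rfl
  | neg α ih => rw [eval, ih]; rfl
  | fusion α β ih ih' => rw [eval, ih, ih']; rfl
  | ldiv α β ih ih' => rw [eval, ih, ih']; rfl
  | inf α β ih ih' => rw [eval, ih, ih']; rfl
  | sup α β ih ih' => rw [eval, ih, ih']; rfl

end Lindenbaum

/-- The Lindenbaum algebra lives in `Type`, hence universe 0; other universes are reached through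
the cut-free calculus. -/
theorem G.complete {α β : Formula} (h : Valid.{0} α β) : G α β := by
  have := h Lindenbaum fun p => Lindenbaum.mk (.var p)
  rwa [Lindenbaum.eval_mk, Lindenbaum.eval_mk] at this

end InFLe

namespace InFLe

/-! ### A cut-free one-sided calculus -/

/-- Signed formulas: `(true, α)` stands for `α` and `(false, α)` for its negation. -/
abbrev Signed : Type := Bool × Formula

/-- The signed formula of opposite sign. -/
def Signed.dual (s : Signed) : Signed := (!s.1, s.2)

/-- The rules with principal formula `s` that keep the context. Each rule is the list of its
premises, and each premise is the list of formulas that take the place of `s`. -/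
def contextRules : Signed → List (List (List Signed))
  | (b, .neg α) => [[[(!b, α)]]]
  | (false, .fusion α β) => [[[(false, α), (false, β)]]]
  | (true, .ldiv α β) => [[[(false, α), (true, β)]]]
  | (true, .inf α β) => [[[(true, α)], [(true, β)]]]
  | (false, .inf α β) => [[[(false, α)]], [[(false, β)]]]
  | (true, .sup α β) => [[[(true, α)]], [[(true, β)]]]
  | (false, .sup α β) => [[[(false, α)], [(false, β)]]]
  | _ => []

/-- The rules with principal formula `s` that split the context between two premises. -/
def splitRules : Signed → List (Signed × Signed)
  | (true, .fusion α β) => [((true, α), (true, β))]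
  | (false, .ldiv α β) => [((true, α), (false, β))]
  | _ => []

/-- Cut-free derivability of a multiset of signed formulas. All contexts are nonempty. -/
inductive CutFree : Multiset Signed → Prop
  | ax (s : Signed) : CutFree (s ::ₘ {s.dual})
  | context {s : Signed} {Γ : Multiset Signed} {r : List (List Signed)} (hΓ : Γ ≠ 0)
      (hr : r ∈ contextRules s) (h : ∀ p ∈ r, CutFree (↑p + Γ)) : CutFree (s ::ₘ Γ)
  | split {s : Signed} {Γ Δ : Multiset Signed} {q : Signed × Signed} (hΓ : Γ ≠ 0) (hΔ : Δ ≠ 0)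
      (hq : q ∈ splitRules s) (h₁ : CutFree (q.1 ::ₘ Γ)) (h₂ : CutFree (q.2 ::ₘ Δ)) :
      CutFree (s ::ₘ (Γ + Δ))

/-! ### Soundness of the cut-free calculus -/

section Soundness

open InCRLSemigroup hiding neg_neg

variable {A : Type u} [InCRLSemigroup A] (μ : ℕ → A)

/-- The value of a signed formula. -/
def Signed.val : Signed → A
  | (true, α) => eval μ α
  | (false, α) => neg (eval μ α)

theorem Signed.val_dual (s : Signed) : s.dual.val μ = neg (s.val μ) := by
  obtain ⟨_ | _, α⟩ := s
  · exact (InCRLSemigroup.neg_neg _).symm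
  · rfl

/-- The product of the negated values, in the monoid with an adjoined unit. -/
def negProd (Γ : Multiset Signed) : WithOne A :=
  (Γ.map fun s => ((neg (s.val μ) : A) : WithOne A)).prod

theorem negProd_cons (s : Signed) (Γ : Multiset Signed) :
    negProd μ (s ::ₘ Γ) = ((neg (s.val μ) : A) : WithOne A) * negProd μ Γ := by
  simp [negProd]

theorem negProd_add (Γ Δ : Multiset Signed) :
    negProd μ (Γ + Δ) = negProd μ Γ * negProd μ Δ := by
  simp [negProd]

theorem exists_negProd_eq {Γ : Multiset Signed} (h : Γ ≠ 0) : ∃ x : A, negProd μ Γ = x := by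
  induction Γ using Multiset.induction with
  | empty => exact absurd rfl h
  | cons s Γ ih =>
    rw [negProd_cons]
    by_cases hΓ : Γ = 0
    · exact ⟨_, by subst hΓ; exact mul_one _⟩
    · obtain ⟨x, hx⟩ := ih hΓ
      exact ⟨neg (s.val μ) * x, by rw [hx, WithOne.coe_mul]⟩

/-- The product of the negated values of `Γ`, if `Γ` is nonempty, is at most `a`. -/
def NegProdLE (Γ : Multiset Signed) (a : A) : Prop := ∀ x : A, negProd μ Γ = x → x ≤ a

variable {μ}

/-- Contraposition with side factor the product of Γ, that is `mul_le_neg_comm`. An empty Γ has no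
product in `A`, and plain antitonicity of negation takes over. -/
theorem NegProdLE.exchange {s t : Signed} {Γ : Multiset Signed}
    (h : NegProdLE μ (t ::ₘ Γ) (s.val μ)) : NegProdLE μ (s ::ₘ Γ) (t.val μ) := by
  intro x hx
  rw [negProd_cons] at hx
  rw [NegProdLE, negProd_cons] at h
  by_cases hΓ : Γ = 0
  · subst hΓ
    have h₁ := WithOne.coe_inj.1 ((mul_one _).symm.trans hx)
    have h₂ := h (neg (t.val μ)) (mul_one _)
    rw [← h₁, ← InCRLSemigroup.neg_neg (t.val μ)]
    exact neg_le_neg h₂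
  · obtain ⟨y, hy⟩ := exists_negProd_eq μ hΓ
    rw [hy, ← WithOne.coe_mul] at hx h
    have h₂ := h _ rfl
    rw [← WithOne.coe_inj.1 hx, ← InCRLSemigroup.neg_neg (t.val μ), mul_le_neg_comm,
      InCRLSemigroup.neg_neg]
    exact h₂

variable (μ) in
/-- Every member of `Γ` is an upper bound of the product of the negated values of the others. -/
def Sound (Γ : Multiset Signed) : Prop := ∀ s Δ, Γ = s ::ₘ Δ → NegProdLE μ Δ (s.val μ)

/-- In a one-sided sequent any member may serve as the succedent, so a rule need only be checked
with its principal formula in that role. -/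
theorem NegProdLE.sound {s : Signed} {Γ : Multiset Signed} (h : NegProdLE μ Γ (s.val μ)) :
    Sound μ (s ::ₘ Γ) := by
  intro t Δ e
  rcases Multiset.cons_eq_cons.1 e with ⟨rfl, rfl⟩ | ⟨-, Θ, rfl, rfl⟩
  · exact h
  · exact h.exchange

theorem Sound.negProdLE_singleton {s : Signed} {Γ : Multiset Signed}
    (h : Sound μ (([s] : List Signed) + Γ)) : NegProdLE μ Γ (s.val μ) := h s Γ rfl

theorem coe_pair_add {σ : Type*} (s t : σ) (Γ : Multiset σ) :
    (([s, t] : List σ) : Multiset σ) + Γ = s ::ₘ t ::ₘ Γ := Multiset.cons_add s {t} Γ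

theorem Sound.mul_le_pair {s t : Signed} {Γ : Multiset Signed}
    (h : Sound μ (([s, t] : List Signed) + Γ)) {x : A} (hx : negProd μ Γ = x) :
    neg (s.val μ) * x ≤ t.val μ := by
  refine h t (s ::ₘ Γ) ?_ _ ?_
  · rw [Multiset.cons_swap]; exact coe_pair_add s t Γ
  · rw [negProd_cons, hx, WithOne.coe_mul]

theorem le_ldiv_iff {a b c : A} : b ≤ ldiv a c ↔ a * b ≤ c := (mul_le_iff_le_ldiv a b c).symm

theorem le_neg_mul_iff {a b c : A} : c ≤ neg (a * b) ↔ a * c ≤ neg b := by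
  rw [le_neg_comm, mul_comm a b, mul_le_neg_comm, mul_comm]

theorem CutFree.sound {Γ : Multiset Signed} (h : CutFree Γ) : Sound μ Γ := by
  induction h with
  | ax s =>
    refine NegProdLE.sound fun x hx => ?_
    rw [negProd, Multiset.map_singleton, Multiset.prod_singleton, WithOne.coe_inj,
      Signed.val_dual, InCRLSemigroup.neg_neg] at hx
    exact hx.ge
  | @context s Γ r hΓ hr _ ih =>
    refine NegProdLE.sound fun x hx => ?_
    obtain ⟨b, α⟩ := s
    cases α <;> cases b <;> simp only [contextRules, List.mem_cons, List.not_mem_nil, or_false]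
      at hr
    all_goals try subst hr
    all_goals try simp only [List.mem_cons, List.not_mem_nil, or_false, forall_eq,
      forall_eq_or_imp] at ih
    · have := ih.negProdLE_singleton x hx
      simpa [Signed.val, eval, InCRLSemigroup.neg_neg] using this
    · exact ih.negProdLE_singleton x hx
    · have := ih.mul_le_pair hx
      simp only [Signed.val, eval, InCRLSemigroup.neg_neg] at this ⊢
      exact le_neg_mul_iff.2 this
    · have := ih.mul_le_pair hx
      simp only [Signed.val, eval, InCRLSemigroup.neg_neg] at this ⊢
      exact le_ldiv_iff.2 this
    · rcases hr with rfl | rfl <;> simp only [List.mem_singleton, forall_eq] at ih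
      · exact (ih.negProdLE_singleton x hx).trans (neg_le_neg inf_le_left)
      · exact (ih.negProdLE_singleton x hx).trans (neg_le_neg inf_le_right)
    · exact le_inf (ih.1.negProdLE_singleton x hx) (ih.2.negProdLE_singleton x hx)
    · exact le_neg_comm.1 (sup_le (le_neg_comm.1 (ih.1.negProdLE_singleton x hx))
        (le_neg_comm.1 (ih.2.negProdLE_singleton x hx)))
    · rcases hr with rfl | rfl <;> simp only [List.mem_singleton, forall_eq] at ih
      · exact (ih.negProdLE_singleton x hx).trans le_sup_left
      · exact (ih.negProdLE_singleton x hx).trans le_sup_right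
  | @split s Γ Δ q hΓ hΔ hq _ _ ih₁ ih₂ =>
    refine NegProdLE.sound fun x hx => ?_
    obtain ⟨y, hy⟩ := exists_negProd_eq μ hΓ
    obtain ⟨z, hz⟩ := exists_negProd_eq μ hΔ
    rw [negProd_add, hy, hz, ← WithOne.coe_mul, WithOne.coe_inj] at hx
    subst hx
    have h₁ := ih₁ _ _ rfl y hy
    have h₂ := ih₂ _ _ rfl z hz
    obtain ⟨b, α⟩ := s
    cases α <;> cases b <;> simp only [splitRules, List.mem_cons, List.not_mem_nil, or_false]
      at hq
    all_goals subst hq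
    · exact mul_le_mul_both h₁ h₂
    -- With y ≤ α and z ≤ ¬β: y·(α\β) ≤ α·(α\β) ≤ β ≤ ¬z, whence α\β ≤ ¬(y·z).
    · exact le_neg_comm.1 (le_neg_mul_iff.2 ((mul_le_mul_both h₁ le_rfl).trans
        ((le_ldiv_iff.1 le_rfl).trans (le_neg_comm.1 h₂))))

theorem CutFree.eval_le {α β : Formula} (h : CutFree ((true, β) ::ₘ {(false, α)})) :
    eval μ α ≤ eval μ β := by
  refine h.sound _ _ rfl _ ?_
  rw [negProd, Multiset.map_singleton, Multiset.prod_singleton, WithOne.coe_inj]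
  exact InCRLSemigroup.neg_neg _

end Soundness

/-! ### Completeness of the cut-free calculus -/

/-- The semigroup of nonempty multisets of signed formulas. -/
def nonemptyContexts : AddSubsemigroup (Multiset Signed) where
  carrier := {Γ | Γ ≠ 0}
  add_mem' h _ e := h (add_eq_zero.1 e).1

/-- Nonempty multisets of signed formulas, in an arbitrary universe. -/
abbrev Context : Type u := ULift.{u} nonemptyContexts

namespace Context

/-- The multiset underlying a context. -/
def toMultiset (x : Context.{u}) : Multiset Signed := x.down.1

theorem ne_zero (x : Context.{u}) : x.toMultiset ≠ 0 := x.down.2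

/-- The context that consists of a single formula. -/
def single (s : Signed) : Context.{u} := ⟨⟨{s}, Multiset.singleton_ne_zero s⟩⟩

end Context

open Context

/-- The contexts that are derivable without cut. -/
def cutFreePole : Set Context.{u} := {x | CutFree x.toMultiset}

theorem mem_perp_single {s : Signed} {x : Context.{u}} :
    x ∈ perp cutFreePole {single s} ↔ CutFree (s ::ₘ x.toMultiset) := by
  refine ⟨fun h => ?_, ?_⟩
  · have := h _ rfl
    rwa [add_comm] at this
  · rintro h _ rfl
    rwa [add_comm]

theorem single_mem_perp {s : Signed} {X : Set Context.{u}} :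
    single s ∈ perp cutFreePole X ↔ ∀ x ∈ X, CutFree (s ::ₘ x.toMultiset) := Iff.rfl

theorem single_mem_fact {s : Signed} {X : Fact cutFreePole.{u}} :
    single s ∈ X.1 ↔ ∀ x ∈ perp cutFreePole X.1, CutFree (s ::ₘ x.toMultiset) := by
  conv_lhs => rw [← X.2]
  exact single_mem_perp

/-- The assignment of the phase algebra of cut-free derivability. -/
def phaseAssignment (p : ℕ) : Fact cutFreePole.{u} := Fact.ofPerp {single (true, .var p)}

/-- The orthogonal of a singleton is a fact, so containment in it can be tested on generators before
closure. This treats the positive fusion and join and the negative residual. -/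
theorem perp_perp_subset_perp_single {s : Signed} {X : Set Context.{u}}
    (h : ∀ x ∈ X, CutFree (s ::ₘ x.toMultiset)) {x : Context.{u}}
    (hx : x ∈ perp cutFreePole (perp cutFreePole X)) : CutFree (s ::ₘ x.toMultiset) := by
  rw [← mem_perp_single, ← perp_perp_perp]
  exact perp_anti _ (perp_anti _ fun y hy => mem_perp_single.2 (h y hy)) hx

/-- Okada's lemma. By `single_mem_fact` the second half says that the one-element context of the
negated α belongs to the value of α. Negation exchanges the halves, so they must be proved together;
each connective uses its own rules, never cut. -/
theorem cutFree_of_mem_eval (α : Formula) :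
    (∀ x ∈ (eval phaseAssignment.{u} α).1, CutFree ((true, α) ::ₘ x.toMultiset)) ∧
    ∀ x ∈ perp cutFreePole (eval phaseAssignment.{u} α).1,
      CutFree ((false, α) ::ₘ x.toMultiset) := by
  induction α with
  | var p =>
    refine ⟨fun x hx => mem_perp_single.1 hx, fun x hx => mem_perp_single.1 ?_⟩
    refine perp_anti _ (Set.singleton_subset_iff.2 ?_) hx
    exact mem_perp_single.2 (CutFree.ax (true, .var p))
  | neg α ih =>
    refine ⟨fun x hx => .context x.ne_zero (List.mem_singleton_self _) ?_,
      fun x hx => .context x.ne_zero (List.mem_singleton_self _) ?_⟩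
    · simpa using ih.2 x hx
    · have hx' : x ∈ (eval phaseAssignment.{u} α).1 := by
        rw [← (eval phaseAssignment.{u} α).2]; exact hx
      simpa using ih.1 x hx'
  | fusion α β ih ih' =>
    refine ⟨fun x hx => perp_perp_subset_perp_single ?_ hx,
      fun x hx => .context x.ne_zero (List.mem_singleton_self _) ?_⟩
    · rintro _ ⟨y, hy, z, hz, rfl⟩
      exact .split y.ne_zero z.ne_zero (List.mem_singleton_self _) (ih.1 y hy) (ih'.1 z hz)
    -- The contexts of the negated α and β lie in the two values, so x is orthogonal to their sum;
    -- this is the premise of the rule.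
    · have hx' := (perp_perp_perp _ _).subset hx _
        ⟨_, single_mem_fact.2 ih.2, _, single_mem_fact.2 ih'.2, rfl⟩
      rw [add_comm, add_assoc] at hx'
      simp only [List.mem_singleton, forall_eq, coe_pair_add]
      exact hx'
  | ldiv α β ih ih' =>
    refine ⟨fun x hx => .context x.ne_zero (List.mem_singleton_self _) ?_,
      fun x hx => perp_perp_subset_perp_single ?_ hx⟩
    · have hx' := hx _ ⟨_, single_mem_fact.2 ih.2, _, single_mem_perp.2 ih'.1, rfl⟩
      rw [add_comm, add_assoc] at hx'
      simp only [List.mem_singleton, forall_eq, coe_pair_add]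
      exact hx'
    · rintro _ ⟨y, hy, z, hz, rfl⟩
      exact .split y.ne_zero z.ne_zero (List.mem_singleton_self _) (ih.1 y hy) (ih'.2 z hz)
  | inf α β ih ih' =>
    refine ⟨fun x hx => .context x.ne_zero (List.mem_singleton_self _) ?_, ?_⟩
    · simpa using ⟨ih.1 x hx.1, ih'.1 x hx.2⟩
    · refine single_mem_fact.1 ⟨single_mem_fact.2 fun x hx => ?_,
        single_mem_fact.2 fun x hx => ?_⟩
      · exact .context (r := [[(false, α)]]) x.ne_zero (by simp [contextRules])
          (by simpa using ih.2 x hx)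
      · exact .context (r := [[(false, β)]]) x.ne_zero (by simp [contextRules])
          (by simpa using ih'.2 x hx)
  | sup α β ih ih' =>
    refine ⟨fun x hx => perp_perp_subset_perp_single ?_ hx,
      fun x hx => .context x.ne_zero (List.mem_singleton_self _) ?_⟩
    · rintro x (hx | hx)
      · exact .context (r := [[(true, α)]]) x.ne_zero (by simp [contextRules])
          (by simpa using ih.1 x hx)
      · exact .context (r := [[(true, β)]]) x.ne_zero (by simp [contextRules])
          (by simpa using ih'.1 x hx)
    · have hx' := (perp_perp_perp _ _).subset hx
      simpa using ⟨ih.2 x (perp_anti _ Set.subset_union_left hx'),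
        ih'.2 x (perp_anti _ Set.subset_union_right hx')⟩

/-- Contexts are lifted to universe `u`, so validity in any single universe suffices. -/
theorem Valid.cutFree {α β : Formula} (h : Valid.{u} α β) :
    CutFree ((true, β) ::ₘ {(false, α)}) :=
  (cutFree_of_mem_eval β).1 _ (h _ phaseAssignment.{u}
    (single_mem_fact.2 (cutFree_of_mem_eval α).2))

theorem G.valid {α β : Formula} (h : G α β) : Valid.{u} α β := fun _ _ μ => h.sound μ

theorem CutFree.derivable {α β : Formula} (h : CutFree ((true, β) ::ₘ {(false, α)})) : G α β :=
  G.complete fun _ _ _ => h.eval_le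

end InFLe

namespace InFLe

/-! ### Decidability of derivability by terminating backward search -/

section Search

variable {σ : Type*} (rules : σ → List (List σ))

/-- Replaces each goal of a list by the premises of a rule for it, in all possible ways. -/
def expandGoals (c : List σ) : List (List σ) :=
  c.foldr (fun s acc => (rules s).flatMap fun r => acc.map fun a => r ++ a) [[]]

/-- Expands all the members of a list of lists of goals. -/
def expandAll (d : List (List σ)) : List (List σ) := d.flatMap (expandGoals rules)

variable {rules}

/-- A list of goals is a conjunction and a list of such lists a disjunction; expansion distributes
the choices of rules and preserves truth. A goal without rules removes its whole conjunction. -/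
theorem exists_mem_expandGoals {P : σ → Prop} (hP : ∀ s, P s ↔ ∃ r ∈ rules s, ∀ p ∈ r, P p)
    (c : List σ) : (∃ e ∈ expandGoals rules c, ∀ s ∈ e, P s) ↔ ∀ s ∈ c, P s := by
  induction c with
  | nil => simp [expandGoals]
  | cons s c ih =>
    rw [List.forall_mem_cons, ← ih, hP s]
    simp only [expandGoals, List.foldr_cons, List.mem_flatMap, List.mem_map]
    constructor
    · rintro ⟨_, ⟨r, hr, a, ha, rfl⟩, h⟩
      exact ⟨⟨r, hr, fun p hp => h p (List.mem_append_left _ hp)⟩,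
        a, ha, fun p hp => h p (List.mem_append_right _ hp)⟩
    · rintro ⟨⟨r, hr, h⟩, a, ha, h'⟩
      exact ⟨_, ⟨r, hr, a, ha, rfl⟩, fun p hp => (List.mem_append.1 hp).elim (h p) (h' p)⟩

theorem exists_mem_expandAll {P : σ → Prop} (hP : ∀ s, P s ↔ ∃ r ∈ rules s, ∀ p ∈ r, P p)
    (d : List (List σ)) :
    (∃ e ∈ expandAll rules d, ∀ s ∈ e, P s) ↔ ∃ c ∈ d, ∀ s ∈ c, P s := by
  refine Iff.trans ?_ (exists_congr fun c => and_congr_right fun _ =>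
    exists_mem_expandGoals hP c)
  simp only [expandAll, List.mem_flatMap]
  constructor
  · rintro ⟨e, ⟨c, hc, he⟩, h⟩
    exact ⟨c, hc, e, he, h⟩
  · rintro ⟨c, hc, e, he, h⟩
    exact ⟨e, ⟨c, hc, he⟩, h⟩

theorem lt_of_mem_expandGoals {m : σ → ℕ} (hm : ∀ s, ∀ r ∈ rules s, ∀ p ∈ r, m p < m s) {k : ℕ}
    {c : List σ} (hc : ∀ s ∈ c, m s < k + 1) :
    ∀ e ∈ expandGoals rules c, ∀ s ∈ e, m s < k := by
  induction c with
  | nil => simp [expandGoals]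
  | cons s c ih =>
    rw [List.forall_mem_cons] at hc
    simp only [expandGoals, List.foldr_cons, List.mem_flatMap, List.mem_map]
    rintro _ ⟨r, hr, a, ha, rfl⟩ p hp
    rcases List.mem_append.1 hp with hp | hp
    · exact (hm s r hr p hp).trans_le (Nat.le_of_lt_succ hc.1)
    · exact ih hc.2 a ha p hp

theorem lt_of_mem_iterate_expandAll {m : σ → ℕ}
    (hm : ∀ s, ∀ r ∈ rules s, ∀ p ∈ r, m p < m s) (n : ℕ) {k : ℕ} {d : List (List σ)}
    (hd : ∀ c ∈ d, ∀ s ∈ c, m s < k + n) :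
    ∀ c ∈ (expandAll rules)^[n] d, ∀ s ∈ c, m s < k := by
  induction n generalizing d with
  | zero => exact hd
  | succ n ih =>
    refine ih fun e he => ?_
    obtain ⟨c, hc, he⟩ := List.mem_flatMap.1 he
    exact lt_of_mem_expandGoals hm (hd c hc) e he

/-- Each round lowers the bound on `m` by one, so after `n` rounds no list can contain a goal. The
disjunction then holds exactly if the empty conjunction is among its members. Search thus becomes an
iteration, which is visibly primitive recursive. -/
theorem iff_nil_mem_iterate_expandAll {P : σ → Prop}
    (hP : ∀ s, P s ↔ ∃ r ∈ rules s, ∀ p ∈ r, P p) {m : σ → ℕ}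
    (hm : ∀ s, ∀ r ∈ rules s, ∀ p ∈ r, m p < m s) {s : σ} {n : ℕ} (hn : m s < n) :
    P s ↔ [] ∈ (expandAll rules)^[n] [[s]] := by
  have h : ∀ n, (∃ e ∈ (expandAll rules)^[n] [[s]], ∀ s ∈ e, P s) ↔ P s := by
    intro n
    induction n with
    | zero => simp
    | succ n ih => rw [Function.iterate_succ_apply', exists_mem_expandAll hP, ih]
  have h' := lt_of_mem_iterate_expandAll hm n (k := 0) (d := [[s]]) (by simpa using hn)
  rw [← h n]
  constructor
  · rintro ⟨e, he, -⟩
    obtain rfl := List.eq_nil_iff_forall_not_mem.2 fun p hp => Nat.not_lt_zero _ (h' e he p hp)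
    exact he
  · exact fun h => ⟨[], h, fun _ hs => absurd hs List.not_mem_nil⟩

end Search

section PrimrecSearch

variable {σ : Type*} [Primcodable σ] {rules : σ → List (List σ)}

theorem primrec_expandGoals (h : Primrec rules) : Primrec (expandGoals rules) := by
  refine Primrec.list_foldr .id (.const _) (Primrec.list_flatMap
    (h.comp (Primrec.fst.comp .snd)) (Primrec.list_map (Primrec.snd.comp (Primrec.snd.comp .fst))
      (Primrec.list_append.comp (Primrec.snd.comp .fst) .snd).to₂).to₂).to₂

theorem primrec_expandAll (h : Primrec rules) : Primrec (expandAll rules) :=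
  Primrec.list_flatMap .id ((primrec_expandGoals h).comp .snd).to₂

theorem primrecPred_eq_nil {α β : Type*} [Primcodable α] [Primcodable β] {f : α → List β}
    (hf : Primrec f) : PrimrecPred fun a => f a = [] := by
  classical exact Primrec.eq.comp hf (.const [])

theorem computablePred_of_search {τ : Type*} [Primcodable τ] (h : Primrec rules) {P : σ → Prop}
    (hP : ∀ s, P s ↔ ∃ r ∈ rules s, ∀ p ∈ r, P p) {m : σ → ℕ}
    (hm : ∀ s, ∀ r ∈ rules s, ∀ p ∈ r, m p < m s) {f : τ → σ} (hf : Primrec f) {n : τ → ℕ}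
    (hn : Primrec n) (hmn : ∀ t, m (f t) < n t) : ComputablePred fun t => P (f t) := by
  have : PrimrecPred fun t => [] ∈ (expandAll rules)^[n t] [[f t]] :=
    ((PrimrecPred.exists_mem_list (primrecPred_eq_nil .id)).comp (Primrec.nat_iterate hn
      (Primrec.list_cons.comp (Primrec.list_cons.comp hf (.const [])) (.const []))
      ((primrec_expandAll h).comp .snd).to₂)).of_eq fun t => by simp
  exact this.computablePred.of_eq fun t => (iff_nil_mem_iterate_expandAll hP hm (hmn t)).symm

end PrimrecSearch

/-! ### The list of all rules for a sequent -/

/-- All the ways to distribute the members of a list over two lists. -/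
def splits {σ : Type*} (l : List σ) : List (List σ × List σ) :=
  l.foldr (fun a acc => acc.flatMap fun q => [(a :: q.1, q.2), (q.1, a :: q.2)]) [([], [])]

theorem coe_eq_of_mem_splits {σ : Type*} {l : List σ} {q : List σ × List σ} (h : q ∈ splits l) :
    (l : Multiset σ) = q.1 + q.2 := by
  induction l generalizing q with
  | nil =>
    obtain rfl := List.mem_singleton.1 h
    rfl
  | cons a l ih =>
    obtain ⟨q, hq, h⟩ := List.mem_flatMap.1 h
    rw [← Multiset.cons_coe, ih hq]
    simp only [List.mem_cons, List.not_mem_nil, or_false] at h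
    rcases h with rfl | rfl
    · rw [← Multiset.cons_coe, Multiset.cons_add]
    · rw [← Multiset.cons_coe, Multiset.add_cons]

theorem exists_mem_splits {σ : Type*} {l : List σ} {Γ Δ : Multiset σ}
    (h : (l : Multiset σ) = Γ + Δ) : ∃ q ∈ splits l, (q.1 : Multiset σ) = Γ ∧ ↑q.2 = Δ := by
  induction l generalizing Γ Δ with
  | nil =>
    obtain ⟨rfl, rfl⟩ := (add_eq_zero (a := Γ) (b := Δ)).1 h.symm
    exact ⟨([], []), List.mem_singleton_self _, rfl, rfl⟩
  | cons a l ih =>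
    have ha : a ∈ Γ + Δ := h ▸ List.mem_cons_self
    rw [← Multiset.cons_coe] at h
    rcases Multiset.mem_add.1 ha with ha | ha <;> obtain ⟨Θ, rfl⟩ := Multiset.exists_cons_of_mem ha
    · rw [Multiset.cons_add, Multiset.cons_inj_right] at h
      obtain ⟨q, hq, rfl, rfl⟩ := ih h
      exact ⟨(a :: q.1, q.2), List.mem_flatMap.2 ⟨q, hq, by simp⟩, rfl, rfl⟩
    · rw [Multiset.add_cons, Multiset.cons_inj_right] at h
      obtain ⟨q, hq, rfl, rfl⟩ := ih h
      exact ⟨(q.1, a :: q.2), List.mem_flatMap.2 ⟨q, hq, by simp⟩, rfl, rfl⟩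

instance : DecidableEq Formula := fun _ _ =>
  decidable_of_iff _ ⟨Formula.toNat_injective, fun h => congrArg Formula.toNat h⟩

/-- The rules of the cut-free calculus with principal formula `s` and context `l`, as lists of
premises. -/
def rulesAt (s : Signed) (l : List Signed) : List (List (List Signed)) :=
  (if l = [s.dual] then [[]] else []) ++
    if l = [] then [] else
      ((contextRules s).map fun r => r.map fun p => p ++ l) ++
        (splitRules s).flatMap fun q => (splits l).flatMap fun c =>
          if c.1 = [] ∨ c.2 = [] then [] else [[q.1 :: c.1, q.2 :: c.2]]

/-- The rules of the cut-free calculus whose conclusion is the multiset of the members of `l`. -/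
def rulesFor (l : List Signed) : List (List (List Signed)) :=
  (splits l).flatMap fun c => if c.1.tail = [] then c.1.flatMap fun s => rulesAt s c.2 else []

/-- The test `c.1.tail = []` also admits an empty first part, but the inner `flatMap` then yields
nothing; what remains is a choice of one principal formula. -/
theorem mem_rulesFor {l : List Signed} {r : List (List Signed)} :
    r ∈ rulesFor l ↔ ∃ s l', ([s], l') ∈ splits l ∧ r ∈ rulesAt s l' := by
  simp only [rulesFor, List.mem_flatMap]
  constructor
  · rintro ⟨⟨_ | ⟨s, _ | ⟨t, c⟩⟩, l'⟩, hc, h⟩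
    · simp at h
    · exact ⟨s, l', hc, by simpa using h⟩
    · simp at h
  · rintro ⟨s, l', h, hr⟩
    exact ⟨_, h, by simpa using hr⟩

theorem mem_rulesAt {s : Signed} {l : List Signed} {r : List (List Signed)} :
    r ∈ rulesAt s l ↔ (l = [s.dual] ∧ r = []) ∨
      (l ≠ [] ∧ ∃ r' ∈ contextRules s, r = r'.map fun p => p ++ l) ∨
      (∃ q ∈ splitRules s, ∃ c ∈ splits l, c.1 ≠ [] ∧ c.2 ≠ [] ∧
        r = [q.1 :: c.1, q.2 :: c.2]) := by
  rw [rulesAt, List.mem_append]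
  refine or_congr ?_ ?_
  · split_ifs with h <;> simp [h]
  · split_ifs with h
    -- The only split of the empty list has empty parts, so the third alternative excludes it by
    -- itself.
    · subst h
      simp [splits]
    · simp only [List.mem_append, List.mem_map, List.mem_flatMap, ne_eq, h, not_false_eq_true,
        true_and, eq_comm (a := r)]
      refine or_congr Iff.rfl (exists_congr fun q => and_congr_right fun _ => exists_congr fun c =>
        and_congr_right fun _ => ?_)
      split_ifs with h'
      · simp only [List.not_mem_nil, false_iff]
        tauto
      · rw [not_or] at h'
        simp [h', eq_comm]

/-- Inversion on the last inference, with multisets represented by lists: this is the hypothesis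
`hP` of the search. -/
theorem cutFree_iff (l : List Signed) :
    CutFree l ↔ ∃ r ∈ rulesFor l, ∀ p ∈ r, CutFree (p : List Signed) := by
  constructor
  · intro h
    generalize hm : (l : Multiset Signed) = Γ at h
    cases h with
    | ax s =>
      obtain ⟨⟨c, l'⟩, hc, h₁, h₂⟩ := exists_mem_splits (Γ := {s}) (Δ := {s.dual}) hm
      obtain rfl := Multiset.coe_eq_singleton.1 h₁
      obtain rfl := Multiset.coe_eq_singleton.1 h₂
      exact ⟨[], mem_rulesFor.2 ⟨s, _, hc, mem_rulesAt.2 (.inl ⟨rfl, rfl⟩)⟩, by simp⟩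
    | @context s Γ r hΓ hr h =>
      obtain ⟨⟨c, l'⟩, hc, h₁, rfl⟩ := exists_mem_splits (Γ := {s}) (Δ := Γ) hm
      obtain rfl := Multiset.coe_eq_singleton.1 h₁
      refine ⟨_, mem_rulesFor.2 ⟨s, _, hc, mem_rulesAt.2 (.inr (.inl
        ⟨fun e => hΓ (by simp [e]), r, hr, rfl⟩))⟩, ?_⟩
      intro p hp
      obtain ⟨p', hp', rfl⟩ := List.mem_map.1 hp
      exact h p' hp'
    | @split s Γ Δ q hΓ hΔ hq h h' =>
      obtain ⟨⟨c, l'⟩, hc, h₁, h₂⟩ := exists_mem_splits (Γ := {s}) (Δ := Γ + Δ) hm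
      obtain rfl := Multiset.coe_eq_singleton.1 h₁
      obtain ⟨c, hc', rfl, rfl⟩ := exists_mem_splits h₂
      refine ⟨_, mem_rulesFor.2 ⟨s, _, hc, mem_rulesAt.2 (.inr (.inr
        ⟨q, hq, c, hc', fun e => hΓ (by simp [e]), fun e => hΔ (by simp [e]), rfl⟩))⟩, ?_⟩
      simpa using ⟨h, h'⟩
  · rintro ⟨r, hr, h⟩
    obtain ⟨s, l', hc, hr⟩ := mem_rulesFor.1 hr
    rw [coe_eq_of_mem_splits hc]
    rcases mem_rulesAt.1 hr with ⟨rfl, rfl⟩ | ⟨hl, r, hr', rfl⟩ | ⟨q, hq, c, hc', h₁, h₂, rfl⟩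
    · exact .ax s
    · refine .context (fun e => hl ((Multiset.coe_eq_zero _).1 e)) hr' fun p hp => ?_
      exact h _ (List.mem_map_of_mem hp)
    · rw [coe_eq_of_mem_splits hc']
      exact .split (fun e => h₁ ((Multiset.coe_eq_zero _).1 e))
        (fun e => h₂ ((Multiset.coe_eq_zero _).1 e)) hq
        (h (q.1 :: c.1) (by simp)) (h (q.2 :: c.2) (by simp))

/-! ### Termination -/

/-- The sum of the Gödel numbers of the members of a multiset of signed formulas. -/
def weight (Γ : Multiset Signed) : ℕ := (Γ.map fun s => s.2.toNat).sum

theorem weight_cons (s : Signed) (Γ : Multiset Signed) :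
    weight (s ::ₘ Γ) = s.2.toNat + weight Γ := by simp [weight]

theorem weight_add (Γ Δ : Multiset Signed) : weight (Γ + Δ) = weight Γ + weight Δ := by
  simp [weight]

/-- Gödel numbers serve as sizes because pairing dominates addition: even a premise that keeps both
immediate subformulas weighs less than the principal formula. -/
theorem weight_lt_of_mem_contextRules {s : Signed} {r : List (List Signed)}
    (hr : r ∈ contextRules s) : ∀ p ∈ r, weight p < s.2.toNat := by
  obtain ⟨b, α⟩ := s
  cases α with
  | var p => simp [contextRules] at hr
  | neg α =>
    simp only [contextRules, List.mem_singleton] at hr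
    subst hr
    simp [weight, Formula.toNat]
    omega
  | _ α β =>
    have := Nat.add_le_pair α.toNat β.toNat
    cases b <;> simp [contextRules] at hr
    all_goals try subst hr
    all_goals try rcases hr with rfl | rfl
    all_goals
      simp [weight, Formula.toNat]
      try omega

theorem toNat_lt_of_mem_splitRules {s : Signed} {q : Signed × Signed} (hq : q ∈ splitRules s) :
    q.1.2.toNat < s.2.toNat ∧ q.2.2.toNat < s.2.toNat := by
  obtain ⟨b, α⟩ := s
  cases α with
  | var p => simp [splitRules] at hq
  | neg α => simp [splitRules] at hq
  | _ α β =>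
    have := Nat.add_le_pair α.toNat β.toNat
    cases b <;> simp [splitRules] at hq
    all_goals
      subst hq
      simp [Formula.toNat]
      omega

theorem weight_lt_of_mem_rulesFor (l : List Signed) :
    ∀ r ∈ rulesFor l, ∀ p ∈ r, weight (p : List Signed) < weight l := by
  intro r hr p hp
  obtain ⟨s, l', hc, hr⟩ := mem_rulesFor.1 hr
  rw [coe_eq_of_mem_splits hc]
  change _ < weight (s ::ₘ ↑l')
  rw [weight_cons]
  rcases mem_rulesAt.1 hr with ⟨rfl, rfl⟩ | ⟨hl, r, hr', rfl⟩ | ⟨q, hq, c, hc', h₁, h₂, rfl⟩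
  · simp at hp
  · obtain ⟨p', hp', rfl⟩ := List.mem_map.1 hp
    rw [← Multiset.coe_add, weight_add]
    exact Nat.add_lt_add_right (weight_lt_of_mem_contextRules hr' p' hp') _
  · have := toNat_lt_of_mem_splitRules hq
    rw [coe_eq_of_mem_splits hc', weight_add]
    simp only [List.mem_cons, List.not_mem_nil, or_false] at hp
    rcases hp with rfl | rfl <;> rw [← Multiset.cons_coe, weight_cons] <;> omega

/-! ### Primitive recursiveness of the rules -/

section Primrec

open Primrec

theorem primrec_splits {σ : Type*} [Primcodable σ] : Primrec (splits (σ := σ)) := by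
  have ha : Primrec fun x : (List σ × σ × List (List σ × List σ)) × List σ × List σ => x.1.2.1 :=
    fst.comp (snd.comp fst)
  have h₁ : Primrec fun x : (List σ × σ × List (List σ × List σ)) × List σ × List σ => x.2.1 :=
    fst.comp snd
  have h₂ : Primrec fun x : (List σ × σ × List (List σ × List σ)) × List σ × List σ => x.2.2 :=
    snd.comp snd
  have h : Primrec₂ fun (_ : List σ) (p : σ × List (List σ × List σ)) =>
      p.2.flatMap fun q => [(p.1 :: q.1, q.2), (q.1, p.1 :: q.2)] :=
    list_flatMap (snd.comp snd) (list_cons.comp ((list_cons.comp ha h₁).pair h₂)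
      (list_cons.comp (h₁.pair (list_cons.comp ha h₂)) (.const [])))
  exact list_foldr .id (.const _) h

theorem primrec_toNat : Primrec Formula.toNat := Primrec.of_equiv (e := Formula.equivNat)

theorem primrec_ofNat : Primrec Formula.ofNat := Primrec.of_equiv_symm (e := Formula.equivNat)

theorem ofNat_toNat (α : Formula) : Formula.ofNat α.toNat = α := Formula.equivNat.left_inv α

/-- The index of the outermost connective. -/
def Formula.tag (α : Formula) : ℕ := α.toNat % 6

/-- The formula whose negation is given. -/
def Formula.negand (α : Formula) : Formula := ofNat (α.toNat / 6)

/-- The left argument of the outermost binary connective. -/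
def Formula.left (α : Formula) : Formula := ofNat (Nat.unpair (α.toNat / 6)).1

/-- The right argument of the outermost binary connective. -/
def Formula.right (α : Formula) : Formula := ofNat (Nat.unpair (α.toNat / 6)).2

theorem primrec_tag : Primrec Formula.tag := nat_mod.comp primrec_toNat (.const 6)

theorem primrec_negand : Primrec Formula.negand :=
  primrec_ofNat.comp (nat_div.comp primrec_toNat (.const 6))

theorem primrec_left : Primrec Formula.left :=
  primrec_ofNat.comp (fst.comp (unpair.comp (nat_div.comp primrec_toNat (.const 6))))

theorem primrec_right : Primrec Formula.right :=
  primrec_ofNat.comp (snd.comp (unpair.comp (nat_div.comp primrec_toNat (.const 6))))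

theorem primrec_singleton {α β : Type*} [Primcodable α] [Primcodable β] {f : α → β}
    (hf : Primrec f) : Primrec fun a => [f a] := list_cons.comp hf (.const [])

theorem mul_six_add_div {n r : ℕ} (h : r < 6) : (6 * n + r) / 6 = n := by omega

/-- Replaces pattern matching by arithmetic on Gödel numbers, where the residue modulo 6 is the
connective, so that closure properties of primitive recursive functions apply. -/
theorem contextRules_eq (s : Signed) : contextRules s =
    if s.2.tag = 1 then [[[(!s.1, s.2.negand)]]]
    else if s.2.tag = 2 then bif s.1 then [] else [[[(false, s.2.left), (false, s.2.right)]]]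
    else if s.2.tag = 3 then bif s.1 then [[[(false, s.2.left), (true, s.2.right)]]] else []
    else if s.2.tag = 4 then
      bif s.1 then [[[(true, s.2.left)], [(true, s.2.right)]]]
      else [[[(false, s.2.left)]], [[(false, s.2.right)]]]
    else if s.2.tag = 5 then
      bif s.1 then [[[(true, s.2.left)]], [[(true, s.2.right)]]]
      else [[[(false, s.2.left)], [(false, s.2.right)]]]
    else [] := by
  obtain ⟨_ | _, α⟩ := s <;> cases α <;>
    simp [contextRules, Formula.tag, Formula.negand, Formula.left, Formula.right, Formula.toNat,
      mul_six_add_div, ofNat_toNat]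

theorem splitRules_eq (s : Signed) : splitRules s =
    if s.2.tag = 2 then bif s.1 then [((true, s.2.left), (true, s.2.right))] else []
    else if s.2.tag = 3 then bif s.1 then [] else [((true, s.2.left), (false, s.2.right))]
    else [] := by
  obtain ⟨_ | _, α⟩ := s <;> cases α <;>
    simp [splitRules, Formula.tag, Formula.left, Formula.right, Formula.toNat,
      mul_six_add_div, ofNat_toNat]

theorem primrecPred_tag (n : ℕ) : PrimrecPred fun s : Signed => s.2.tag = n :=
  Primrec.eq.comp (primrec_tag.comp snd) (.const n)

theorem primrec_signed_left (b : Bool) : Primrec fun s : Signed => (b, s.2.left) :=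
  (Primrec.const b).pair (primrec_left.comp snd)

theorem primrec_signed_right (b : Bool) : Primrec fun s : Signed => (b, s.2.right) :=
  (Primrec.const b).pair (primrec_right.comp snd)

theorem primrec_contextRules : Primrec contextRules := by
  have single {f : Signed → Signed} (hf : Primrec f) : Primrec fun s => [[[f s]]] :=
    primrec_singleton (primrec_singleton (primrec_singleton hf))
  have together {f g : Signed → Signed} (hf : Primrec f) (hg : Primrec g) :
      Primrec fun s => [[[f s, g s]]] :=
    primrec_singleton (primrec_singleton (list_cons.comp hf (primrec_singleton hg)))
  have both {f g : Signed → Signed} (hf : Primrec f) (hg : Primrec g) :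
      Primrec fun s => [[[f s], [g s]]] :=
    primrec_singleton (list_cons.comp (primrec_singleton hf)
      (primrec_singleton (primrec_singleton hg)))
  have either {f g : Signed → Signed} (hf : Primrec f) (hg : Primrec g) :
      Primrec fun s => [[[f s]], [[g s]]] :=
    list_cons.comp (primrec_singleton (primrec_singleton hf)) (single hg)
  have hl := primrec_signed_left
  have hr := primrec_signed_right
  refine Primrec.of_eq ?_ fun s => (contextRules_eq s).symm
  refine .ite (primrecPred_tag 1) (single ((Primrec.not.comp fst).pair (primrec_negand.comp snd)))
    (.ite (primrecPred_tag 2) (.cond fst (.const []) (together (hl _) (hr _)))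
    (.ite (primrecPred_tag 3) (.cond fst (together (hl _) (hr _)) (.const []))
    (.ite (primrecPred_tag 4) (.cond fst (both (hl _) (hr _)) (either (hl _) (hr _)))
    (.ite (primrecPred_tag 5) (.cond fst (either (hl _) (hr _)) (both (hl _) (hr _)))
      (.const [])))))

theorem primrec_splitRules : Primrec splitRules := by
  refine Primrec.of_eq ?_ fun s => (splitRules_eq s).symm
  refine .ite (primrecPred_tag 2) (.cond fst
    (primrec_singleton ((primrec_signed_left _).pair (primrec_signed_right _))) (.const []))
    (.ite (primrecPred_tag 3) (.cond fst (.const [])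
    (primrec_singleton ((primrec_signed_left _).pair (primrec_signed_right _)))) (.const []))

theorem primrec_dual : Primrec Signed.dual := (Primrec.not.comp fst).pair snd

theorem primrec_rulesAt : Primrec₂ rulesAt := by
  refine list_append.comp (.ite (Primrec.eq.comp snd (primrec_singleton (primrec_dual.comp fst)))
    (.const _) (.const _)) (.ite (primrecPred_eq_nil snd) (.const _) (list_append.comp ?_ ?_))
  · exact list_map (primrec_contextRules.comp fst)
      (list_map snd (list_append.comp snd (snd.comp (fst.comp fst))).to₂).to₂
  · have h₁ : Primrec fun x : ((Signed × List Signed) × Signed × Signed) ×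
      List Signed × List Signed => x.2.1 := fst.comp snd
    have h₂ : Primrec fun x : ((Signed × List Signed) × Signed × Signed) ×
      List Signed × List Signed => x.2.2 := snd.comp snd
    have hc : PrimrecPred fun x : ((Signed × List Signed) × Signed × Signed) ×
      List Signed × List Signed => x.2.1 = [] ∨ x.2.2 = [] :=
      (primrecPred_eq_nil h₁).or (primrecPred_eq_nil h₂)
    have hr : Primrec fun x : ((Signed × List Signed) × Signed × Signed) ×
      List Signed × List Signed =>
        [[x.1.2.1 :: x.2.1, x.1.2.2 :: x.2.2]] :=
      primrec_singleton (list_cons.comp (list_cons.comp (fst.comp (snd.comp fst)) h₁)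
        (primrec_singleton (list_cons.comp (snd.comp (snd.comp fst)) h₂)))
    have hg : Primrec₂ fun (x : (Signed × List Signed) × Signed × Signed)
        (c : List Signed × List Signed) =>
          if c.1 = [] ∨ c.2 = [] then [] else [[x.2.1 :: c.1, x.2.2 :: c.2]] :=
      Primrec.ite hc (.const []) hr
    have h : Primrec₂ fun (x : Signed × List Signed) (q : Signed × Signed) =>
        (splits x.2).flatMap fun c =>
          if c.1 = [] ∨ c.2 = [] then [] else [[q.1 :: c.1, q.2 :: c.2]] :=
      list_flatMap (primrec_splits.comp (snd.comp fst)) hg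
    exact list_flatMap (primrec_splitRules.comp fst) h

theorem primrec_rulesFor : Primrec rulesFor := by
  have hs : Primrec₂ fun (x : List Signed × List Signed × List Signed) (s : Signed) =>
      rulesAt s x.2.2 := primrec_rulesAt.comp snd (snd.comp (snd.comp fst))
  have h : Primrec fun x : List Signed × List Signed × List Signed =>
      x.2.1.flatMap fun s => rulesAt s x.2.2 := list_flatMap (fst.comp snd) hs
  have hc : PrimrecPred fun x : List Signed × List Signed × List Signed => x.2.1.tail = [] :=
    primrecPred_eq_nil (list_tail.comp (fst.comp snd))
  have hg : Primrec₂ fun (_ : List Signed) (c : List Signed × List Signed) =>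
      if c.1.tail = [] then c.1.flatMap fun s => rulesAt s c.2 else [] :=
    Primrec.ite hc h (.const [])
  exact list_flatMap primrec_splits hg

end Primrec

/-! ### Decidability of the logic -/

theorem G_iff_cutFree {α β : Formula} :
    G α β ↔ CutFree (([(true, β), (false, α)] : List Signed) : Multiset Signed) :=
  ⟨fun h => h.valid.{0}.cutFree, CutFree.derivable⟩

theorem computablePred_G : ComputablePred fun s : Formula × Formula => G s.1 s.2 := by
  have hf : Primrec fun s : Formula × Formula => ([(true, s.2), (false, s.1)] : List Signed) :=
    Primrec.list_cons.comp ((Primrec.const true).pair .snd)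
      (primrec_singleton ((Primrec.const false).pair .fst))
  -- The number of rounds is the weight of the initial goal plus one, since it must exceed that
  -- weight strictly.
  have hn : Primrec fun s : Formula × Formula => s.2.toNat + s.1.toNat + 1 :=
    Primrec.succ.comp (Primrec.nat_add.comp (primrec_toNat.comp .snd) (primrec_toNat.comp .fst))
  refine (computablePred_of_search (P := fun l : List Signed => CutFree l)
    (m := fun l : List Signed => weight l) primrec_rulesFor cutFree_iff
    weight_lt_of_mem_rulesFor hf hn fun s => ?_).of_eq fun s => G_iff_cutFree.symm
  simp [weight]

theorem G_iff_valid (α β : Formula) : G α β ↔ Valid.{u} α β :=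
  ⟨G.valid, fun h => h.cutFree.derivable⟩

end InFLe

theorem mainTheorem1 :
    ComputablePred (fun s : InFLe.Formula × InFLe.Formula => InFLe.Valid.{u} s.1 s.2) ∧
    ComputablePred (fun s : InFLe.Formula × InFLe.Formula => InFLe.G s.1 s.2) ∧
    ∀ α β : InFLe.Formula, InFLe.G α β ↔ InFLe.Valid.{u} α β :=
  ⟨InFLe.computablePred_G.of_eq fun s => InFLe.G_iff_valid s.1 s.2, InFLe.computablePred_G,
    InFLe.G_iff_valid⟩
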